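/- For $\operatorname{Re}(z)>0$ and $q\neq 0,-1,-2,\dots$ let $\zeta_E(z,q)=\sum_{n=0}^\infty \frac{(-1)^n}{(n+q)^z}$ be the alternating Hurwitz zeta function (the series being summed in its natural order), and define the modified Stieltjes constants $\tilde\gamma_k(q)$ by the Taylor expansion at $z=1$ $$\zeta_E(z,q)=\sum_{k=0}^\infty\frac{(-1)^k\tilde\gamma_k(q)}{k!}(z-1)^k,\qquad \tilde\gamma_k:=\tilde\gamma_k(1).$$ Let $\gamma$ be the Euler constant, and let ${}_3F_4$ be the generalized hypergeometric function, so that $${}_3F_4\left(1,1,1;2,2,2,\tfrac52;z\right)=\sum_{n=0}^\infty\frac{1}{(n+1)^3}\,\frac{\Gamma(5/2)}{\Gamma(5/2+n)}\,\frac{z^n}{n!}.$$ Then the series below converges, and $$\begin{aligned}\tilde\gamma_1=\frac12-\log 2-2\sum_{k=0}^\infty\Big(&1+\frac12(\gamma-2)\gamma-\frac{\pi^2}{24}-\frac{(2k+1)^2\pi^2}{24}\;{}_3F_4\left(1,1,1;2,2,2,\tfrac52;-\frac{(2k+1)^2\pi^2}{4}\right)\\&+\log\big((2k+1)\pi\big)\Big(\gamma-1+\frac12\log\big((2k+1)\pi\big)\Big)\Big).\end{aligned}$$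 -/

import Mathlib

/-- The alternating Hurwitz zeta function `ζ_E(z, q) = ∑_{n ≥ 0} (-1)^n / (n + q)^z` for
`Re z > 0` and `q ≠ 0, -1, -2, …`. For `0 < Re z ≤ 1` the series converges only conditionally, so
it is summed in its natural order (the limit of the sums over `n < N` as `N → ∞`). This half plane
is an open neighbourhood of `z = 1`, so no continuation is needed for the expansion there. -/
noncomputable def alternatingHurwitzZeta (z q : ℂ) : ℂ :=
  ∑'[SummationFilter.conditional ℕ] n : ℕ, (-1 : ℂ) ^ n / ((n : ℂ) + q) ^ z

/-- The modified Stieltjes constants `γ̃_k(q)`, defined by the Taylor expansion at `z = 1`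
`ζ_E(z, q) = ∑_{k ≥ 0} ((-1)^k γ̃_k(q) / k!) (z - 1)^k`: the `k`-th derivative of `ζ_E(·, q)` at
`1` is `(-1)^k γ̃_k(q)`. -/
noncomputable def modifiedStieltjes (k : ℕ) (q : ℂ) : ℂ :=
  (-1 : ℂ) ^ k * iteratedDeriv k (fun z : ℂ => alternatingHurwitzZeta z q) 1

/-- The generalized hypergeometric function `pFq(a₁, …, a_p; b₁, …, b_q; z)`, that is
`∑_n ((a₁)_n ⋯ (a_p)_n / ((b₁)_n ⋯ (b_q)_n)) z^n / n!`. Mathlib's regularized function is this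
series divided by `Γ(b₁) ⋯ Γ(b_q)`. -/
noncomputable def hypergeometricPFQ (a b : Multiset ℂ) (z : ℂ) : ℂ :=
  (b.map Complex.Gamma).prod * Complex.regularizedHGFun a b z

/-- The defining series of `₃F₄(1, 1, 1; 2, 2, 2, c; z)`. -/
theorem hypergeometricPFQ_three_four (c z : ℂ) :
    hypergeometricPFQ {1, 1, 1} {2, 2, 2, c} z =
      ∑' n : ℕ, 1 / ((n : ℂ) + 1) ^ 3 * (Complex.Gamma c / Complex.Gamma (c + n)) *
        (z ^ n / (n.factorial : ℂ)) := by
  have hG (n : ℕ) : Complex.Gamma (2 + n) = ((n : ℂ) + 1) * n.factorial := by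
    have h := Complex.Gamma_nat_eq_factorial (n + 1)
    rw [show (2 : ℂ) + n = ((n + 1 : ℕ) : ℂ) + 1 by push_cast; ring, h, Nat.factorial_succ]
    push_cast
    ring
  unfold hypergeometricPFQ Complex.regularizedHGFun FormalMultilinearSeries.sum
  rw [← tsum_mul_left]
  refine tsum_congr fun n => ?_
  have hf : (n.factorial : ℂ) ≠ 0 := by exact_mod_cast n.factorial_ne_zero
  have hn : (n : ℂ) + 1 ≠ 0 := by exact_mod_cast n.succ_ne_zero
  rw [FormalMultilinearSeries.apply_eq_pow_smul_coeff, Complex.regularizedHGFunSeries_coeff]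
  simp [Complex.regularizedHGFunCoeff, hG]
  field_simp

/-- The `k`-th term of the hypergeometric series for `γ̃₁`; it depends on `k` through
`κ = (2k + 1)π`, and the logarithm is `log κ`. -/
noncomputable def stieltjesTerm (k : ℕ) : ℂ :=
  1 + 1 / 2 * ((Real.eulerMascheroniConstant : ℂ) - 2) * (Real.eulerMascheroniConstant : ℂ)
    - (Real.pi : ℂ) ^ 2 / 24
    - (2 * (k : ℂ) + 1) ^ 2 * (Real.pi : ℂ) ^ 2 / 24 *
        hypergeometricPFQ {1, 1, 1} {2, 2, 2, 5 / 2}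
          (-((2 * (k : ℂ) + 1) ^ 2 * (Real.pi : ℂ) ^ 2 / 4))
    + (Real.log ((2 * (k : ℝ) + 1) * Real.pi) : ℂ) *
        ((Real.eulerMascheroniConstant : ℂ) - 1
          + 1 / 2 * (Real.log ((2 * (k : ℝ) + 1) * Real.pi) : ℂ))

/-!
Write `κ = (2k + 1) π`. Clearing Gamma factors turns the hypergeometric part of the `k`-th term into
`∑_{m ≥ 1} (-1)^(m-1) κ^(2m) / ((2m)² (2m+1)!)` (`sincLogSeries`), which is the integral of
`log t / t * (sin (κ t) / (κ t) - 1)` over `(0, 1]`. The remaining constants complete it to a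
convergent oscillating integral (`integral_log_mul_sin`): the `k`-th term is
`∫_1^∞ (log t / t) (sin (κ t) / (κ t)) dt`.

To see this, subtract `1` from `sin (κ t) / (κ t)` on `(0, 1]` and let `c(s)` be the Mellin transform
of the difference. It is holomorphic near `0`, and `c'(0)` is the sum of the two integrals above. For
`0 < s < 1` the Mellin transform of the sine (`hasMellin_sin`) gives
`(1 - s) (1 + s c(s)) = Γ(1 + s) cos (π s / 2) κ^(-s)`, so that the identity theorem and the quadratic
Taylor coefficients at `0` determine `c'(0)` in terms of `Γ'(1) = -γ`, `Γ''(1) = γ² + π² / 6` and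
`log κ`.

One integration by parts makes the terms `O(κ⁻²)`, so the sum over `k` may be taken under the
integral. There `∑ cos ((2k + 1) π t) / ((2k + 1) π)²` is a triangle wave, linear between consecutive
integers, and integrating over the intervals `[n, n + 1]` (`integral_triangleWave_mul`) leaves
`1/4 - log 2 / 2 + η'(1) / 2`, where `η'(1) = ∑ (-1)^n log n / n` is the derivative of
`ζ_E(·, 1)` at `1`, obtained by differentiating the alternating series with its terms grouped in
pairs (`hasSum_deriv_alternatingHurwitzZeta_one`).
-/

section

open MeasureTheory Set Filter Topology Asymptotics

/-! ### The Mellin transform of the sine -/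

theorem norm_one_sub_exp_neg_le_two {z : ℂ} (hz : 0 ≤ z.re) : ‖1 - Complex.exp (-z)‖ ≤ 2 := by
  refine (norm_sub_le _ _).trans ?_
  have : ‖Complex.exp (-z)‖ ≤ 1 := by
    rw [Complex.norm_exp, Complex.neg_re]
    exact Real.exp_le_one_iff.mpr (by linarith)
  rw [norm_one]
  linarith

theorem norm_one_sub_exp_neg_le_norm {z : ℂ} (hz : 0 ≤ z.re) : ‖1 - Complex.exp (-z)‖ ≤ ‖z‖ := by
  have h := (convex_halfSpace_re_ge 0).norm_image_sub_le_of_norm_hasDerivWithin_le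
    (f := fun w : ℂ => Complex.exp (-w)) (f' := fun w => -Complex.exp (-w)) (C := 1)
    (fun w _ => by simpa using ((hasDerivAt_neg w).cexp).hasDerivWithinAt)
    (fun w hw => by
      rw [norm_neg, Complex.norm_exp, Complex.neg_re]
      have : 0 ≤ w.re := hw
      exact Real.exp_le_one_iff.mpr (by linarith))
    (show (z : ℂ) ∈ {w : ℂ | 0 ≤ w.re} from hz) (show (0 : ℂ) ∈ {w : ℂ | 0 ≤ w.re} by simp)
  simpa using h

theorem norm_one_sub_exp_neg_mul_le {r : ℂ} (hr : 0 ≤ r.re) {t : ℝ} (ht : 0 < t) :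
    ‖1 - Complex.exp (-(r * t))‖ ≤ (2 + ‖r‖) * min 1 t := by
  have hre : 0 ≤ (r * t).re := by
    rw [Complex.re_mul_ofReal]; positivity
  have h1 := norm_one_sub_exp_neg_le_two hre
  have h2 := norm_one_sub_exp_neg_le_norm hre
  rw [norm_mul, Complex.norm_real, Real.norm_of_nonneg ht.le] at h2
  have := norm_nonneg r
  rcases le_total 1 t with h | h
  · rw [min_eq_left h]; linarith
  · rw [min_eq_right h]; nlinarith

theorem integrableOn_rpow_mul_min_one {p : ℝ} (h₀ : 0 < p) (h₁ : p < 1) :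
    IntegrableOn (fun t : ℝ => t ^ (p - 2) * min 1 t) (Ioi 0) := by
  have := mellin_convergent_of_isBigO_scalar (f := fun t : ℝ => min 1 t) (s := p - 1) (a := 0)
    (b := -1)
    ((by fun_prop : Continuous fun t : ℝ => min 1 t).locallyIntegrable.locallyIntegrableOn _)
    (by
      refine IsBigO.of_bound 1 ?_
      filter_upwards [eventually_ge_atTop (0 : ℝ)] with t ht
      simp [abs_of_nonneg (le_min zero_le_one ht)])
    (by linarith)
    (by
      refine IsBigO.of_bound 1 ?_
      filter_upwards [self_mem_nhdsWithin] with t ht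
      have ht : 0 < t := ht
      simp [abs_of_nonneg (le_min zero_le_one ht.le), abs_of_pos ht])
    (by linarith)
  simpa [sub_sub, one_add_one_eq_two] using this

/-- The Mellin transform of `t ↦ 1 - exp (-r t)` at `s - 1`. -/
noncomputable def mellinOneSubExp (s r : ℂ) : ℂ :=
  mellin (fun t : ℝ => 1 - Complex.exp (-(r * t))) (s - 1)

theorem norm_cpow_smul_one_sub_exp_le {s r : ℂ} (hr : 0 ≤ r.re) {t : ℝ} (ht : 0 < t) :
    ‖(t : ℂ) ^ (s - 1 - 1) • (1 - Complex.exp (-(r * t)))‖ ≤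
      (2 + ‖r‖) * (t ^ (s.re - 2) * min 1 t) := by
  rw [norm_smul, Complex.norm_cpow_eq_rpow_re_of_pos ht]
  have := norm_one_sub_exp_neg_mul_le hr ht
  have h2 : (s - 1 - 1).re = s.re - 2 := by simp; ring
  rw [h2]
  calc _ ≤ t ^ (s.re - 2) * ((2 + ‖r‖) * min 1 t) := by gcongr
    _ = _ := by ring

theorem aestronglyMeasurable_cpow_smul {f : ℝ → ℂ} (hf : Continuous f) (s : ℂ) :
    AEStronglyMeasurable (fun t : ℝ => (t : ℂ) ^ s • f t) (volume.restrict (Ioi 0)) := by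
  refine ContinuousOn.aestronglyMeasurable (fun t ht => ?_) measurableSet_Ioi
  exact ((Complex.continuousAt_ofReal_cpow_const _ _ (Or.inr (ne_of_gt ht))).mul
    hf.continuousAt).continuousWithinAt

theorem mellinConvergent_one_sub_exp {s r : ℂ} (h₀ : 0 < s.re) (h₁ : s.re < 1) (hr : 0 ≤ r.re) :
    MellinConvergent (fun t : ℝ => 1 - Complex.exp (-(r * t))) (s - 1) := by
  refine Integrable.mono' ((integrableOn_rpow_mul_min_one h₀ h₁).const_mul (2 + ‖r‖))
    (aestronglyMeasurable_cpow_smul (by fun_prop) _) ?_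
  filter_upwards [ae_restrict_mem measurableSet_Ioi] with t ht
  exact norm_cpow_smul_one_sub_exp_le hr ht

theorem continuousOn_mellinOneSubExp {s : ℂ} (h₀ : 0 < s.re) (h₁ : s.re < 1) :
    ContinuousOn (mellinOneSubExp s) {r | 0 ≤ r.re} := by
  intro r₀ hr₀
  unfold mellinOneSubExp mellin
  refine tendsto_integral_filter_of_dominated_convergence
    (fun t : ℝ => (2 + (‖r₀‖ + 1)) * (t ^ (s.re - 2) * min 1 t)) (Eventually.of_forall fun r =>
      aestronglyMeasurable_cpow_smul (by fun_prop) _) ?_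
    ((integrableOn_rpow_mul_min_one h₀ h₁).const_mul _) ?_
  · have : ∀ᶠ r in 𝓝[{r : ℂ | 0 ≤ r.re}] r₀, ‖r‖ < ‖r₀‖ + 1 :=
      (continuous_norm.continuousWithinAt.eventually_lt_const (by linarith))
    filter_upwards [this, self_mem_nhdsWithin] with r hr hr'
    filter_upwards [ae_restrict_mem measurableSet_Ioi] with t ht
    have ht : 0 < t := ht
    refine (norm_cpow_smul_one_sub_exp_le hr' ht).trans ?_
    gcongr
  · refine Eventually.of_forall fun t => ?_
    exact (by fun_prop : Continuous fun r : ℂ => (t : ℂ) ^ (s - 1 - 1) •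
      (1 - Complex.exp (-(r * t)))).continuousWithinAt

theorem hasDerivAt_mellinOneSubExp {s r : ℂ} (h₀ : 0 < s.re) (h₁ : s.re < 1) (hr : 0 < r.re) :
    HasDerivAt (mellinOneSubExp s) (mellin (fun t : ℝ => Complex.exp (-(r * t))) s) r := by
  unfold mellinOneSubExp mellin
  have hball : ∀ w ∈ Metric.ball r (r.re / 2), r.re / 2 ≤ w.re := by
    intro w hw
    have := (Complex.abs_re_le_norm (w - r)).trans_lt (by simpa [dist_eq_norm] using hw)
    rw [Complex.sub_re, abs_lt] at this
    linarith [this.1]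
  refine (hasDerivAt_integral_of_dominated_loc_of_deriv_le
    (bound := fun t : ℝ => t ^ (s.re - 1) * Real.exp (-(r.re / 2 * t)))
    (F := fun w (t : ℝ) => (t : ℂ) ^ (s - 1 - 1) • (1 - Complex.exp (-(w * t))))
    (F' := fun w (t : ℝ) => (t : ℂ) ^ (s - 1) • Complex.exp (-(w * t)))
    (Metric.ball_mem_nhds r (half_pos hr)) (Eventually.of_forall fun w =>
      aestronglyMeasurable_cpow_smul (by fun_prop) _)
    (mellinConvergent_one_sub_exp h₀ h₁ hr.le)
    (aestronglyMeasurable_cpow_smul (by fun_prop) _) ?_ ?_ ?_).2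
  · filter_upwards [ae_restrict_mem measurableSet_Ioi] with t ht w hw
    have ht : 0 < t := ht
    rw [norm_smul, Complex.norm_cpow_eq_rpow_re_of_pos ht, Complex.norm_exp, Complex.neg_re,
      Complex.re_mul_ofReal, Complex.sub_re, Complex.one_re]
    have := hball w hw
    gcongr
  · have := integrableOn_rpow_mul_exp_neg_mul_rpow (p := 1) (s := s.re - 1) (b := r.re / 2)
      (by linarith) zero_lt_one (half_pos hr)
    simpa [IntegrableOn] using this
  · filter_upwards [ae_restrict_mem measurableSet_Ioi] with t ht w hw
    have ht : (t : ℂ) ≠ 0 := by exact_mod_cast (ne_of_gt ht)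
    have h : HasDerivAt (fun w : ℂ => 1 - Complex.exp (-(w * t)))
        (t * Complex.exp (-(w * t))) w := by
      have := (((hasDerivAt_id w).mul_const (t : ℂ)).neg.cexp).const_sub 1
      convert! this using 1
      simp; ring
    convert! h.const_smul ((t : ℂ) ^ (s - 1 - 1)) using 1
    rw [smul_eq_mul, smul_eq_mul, Complex.cpow_sub (s - 1) 1 ht, Complex.cpow_one]
    field_simp

/-- Homogeneity in `r`, extended from the positive reals to the right half plane. -/
theorem mellinOneSubExp_eq_of_re_pos {s r : ℂ} (h₀ : 0 < s.re) (h₁ : s.re < 1) (hr : 0 < r.re) :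
    mellinOneSubExp s r = r ^ (1 - s) * mellinOneSubExp s 1 := by
  have hU : IsOpen {r : ℂ | 0 < r.re} := isOpen_lt continuous_const Complex.continuous_re
  have hf : AnalyticOnNhd ℂ (mellinOneSubExp s) {r | 0 < r.re} :=
    DifferentiableOn.analyticOnNhd (fun r hr =>
      (hasDerivAt_mellinOneSubExp h₀ h₁ hr).differentiableAt.differentiableWithinAt) hU
  have hg : AnalyticOnNhd ℂ (fun r : ℂ => r ^ (1 - s) * mellinOneSubExp s 1) {r | 0 < r.re} :=
    DifferentiableOn.analyticOnNhd (fun r hr =>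
      (((hasDerivAt_id r).cpow_const (Or.inl hr)).mul_const
        _).differentiableAt.differentiableWithinAt) hU
  refine hf.eqOn_of_preconnected_of_frequently_eq hg
    (convex_halfSpace_re_gt 0).isPreconnected (z₀ := 1) (by simp) ?_ hr
  -- On the positive reals the identity is the substitution `t ↦ r t`.
  have hreal : ∀ x : ℝ, 0 < x →
      mellinOneSubExp s x = (x : ℂ) ^ (1 - s) * mellinOneSubExp s 1 := by
    intro x hx
    have := mellin_comp_mul_left (fun t : ℝ => 1 - Complex.exp (-(1 * (t : ℂ)))) (s - 1) hx
    rw [neg_sub, smul_eq_mul] at this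
    unfold mellinOneSubExp
    rw [← this]
    simp
  have htend : Tendsto (fun n : ℕ => ((1 + 1 / ((n : ℝ) + 1) : ℝ) : ℂ)) atTop (𝓝[≠] 1) := by
    refine tendsto_nhdsWithin_iff.mpr ⟨?_, Eventually.of_forall fun n => ?_⟩
    · have := (tendsto_one_div_add_atTop_nhds_zero_nat (𝕜 := ℝ)).const_add 1
      rw [add_zero] at this
      exact_mod_cast (Complex.continuous_ofReal.tendsto _).comp this
    · have : (1 + 1 / ((n : ℝ) + 1) : ℝ) ≠ 1 := by
        have : 0 < 1 / ((n : ℝ) + 1) := by positivity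
        linarith
      exact fun h => this (Complex.ofReal_injective (by simpa using h))
  exact htend.frequently (Frequently.of_forall fun n => hreal _ (by positivity))

/-- The scaling law makes the derivative of `mellinOneSubExp s` at `1` equal to
`(1 - s) * mellinOneSubExp s 1`; differentiation under the integral makes it `Γ(s)`. -/
theorem mellinOneSubExp_one {s : ℂ} (h₀ : 0 < s.re) (h₁ : s.re < 1) :
    (1 - s) * mellinOneSubExp s 1 = Complex.Gamma s := by
  have h1 := hasDerivAt_mellinOneSubExp h₀ h₁ (r := 1) (by simp)
  have h2 : HasDerivAt (mellinOneSubExp s) ((1 - s) * mellinOneSubExp s 1) 1 := by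
    have := ((hasDerivAt_id (1 : ℂ)).cpow_const (c := 1 - s) (Or.inl (by simp))).mul_const
      (mellinOneSubExp s 1)
    have h3 : mellinOneSubExp s =ᶠ[𝓝 1] fun r => id r ^ (1 - s) * mellinOneSubExp s 1 := by
      filter_upwards [(isOpen_lt continuous_const Complex.continuous_re).mem_nhds
        (show (1 : ℂ) ∈ {r : ℂ | 0 < r.re} by simp)] with r hr
      exact mellinOneSubExp_eq_of_re_pos h₀ h₁ hr
    simpa using this.congr_of_eventuallyEq h3
  rw [h2.unique h1, Complex.Gamma_eq_integral h₀, Complex.GammaIntegral_eq_mellin]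
  simp [mellin]

/-- Unlike the Mellin transform of `exp (-r t)` itself, this one converges absolutely up to the
imaginary axis, where the formula persists by continuity. -/
theorem mellinOneSubExp_eq {s r : ℂ} (h₀ : 0 < s.re) (h₁ : s.re < 1) (hr : 0 ≤ r.re)
    (hr' : r ∈ Complex.slitPlane) :
    mellinOneSubExp s r = r ^ (1 - s) * (Complex.Gamma s / (1 - s)) := by
  have hs : 1 - s ≠ 0 := fun h => by
    have := congrArg Complex.re h
    simp at this
    linarith
  rw [← mellinOneSubExp_one h₀ h₁, mul_div_cancel_left₀ _ hs]
  have htend : Tendsto (fun ε : ℝ => r + ε) (𝓝[>] 0) (𝓝[{r | 0 ≤ r.re}] r) := by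
    refine tendsto_nhdsWithin_iff.mpr ⟨?_, ?_⟩
    · have : Continuous (fun ε : ℝ => r + ε) := by fun_prop
      simpa using (this.tendsto 0).mono_left nhdsWithin_le_nhds
    · filter_upwards [self_mem_nhdsWithin] with ε hε
      have : 0 < ε := hε
      simp; linarith
  have hL := (continuousOn_mellinOneSubExp h₀ h₁ r hr).tendsto.comp htend
  have hR : ContinuousAt (fun r : ℂ => r ^ (1 - s) * mellinOneSubExp s 1) r :=
    ((hasDerivAt_id r).cpow_const (c := 1 - s) hr').continuousAt.mul continuousAt_const
  have hR' := hR.tendsto.comp (htend.mono_right nhdsWithin_le_nhds)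
  refine tendsto_nhds_unique hL (hR'.congr' ?_)
  filter_upwards [self_mem_nhdsWithin] with ε hε
  have : 0 < ε := hε
  exact (mellinOneSubExp_eq_of_re_pos h₀ h₁ (by simp; linarith)).symm

/-- `∫_0^∞ t^(s-2) sin t dt`, from the values of `mellinOneSubExp s` at `± i`. -/
theorem hasMellin_sin {s : ℂ} (h₀ : 0 < s.re) (h₁ : s.re < 1) :
    HasMellin (fun t : ℝ => Complex.sin t) (s - 1)
      (Complex.Gamma s / (1 - s) * Complex.sin (Real.pi * (1 - s) / 2)) := by
  have hI := mellinConvergent_one_sub_exp h₀ h₁ (r := Complex.I) (by simp)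
  have hI' := mellinConvergent_one_sub_exp h₀ h₁ (r := -Complex.I) (by simp)
  have h := hasMellin_const_smul (hasMellin_sub hI hI').1 (1 / (2 * Complex.I))
  have hfun : (fun t : ℝ => (1 / (2 * Complex.I)) • ((1 - Complex.exp (-(Complex.I * t))) -
      (1 - Complex.exp (-(-Complex.I * t))))) = fun t : ℝ => Complex.sin t := by
    funext t
    rw [Complex.sin, smul_eq_mul]
    have : Complex.I ≠ 0 := Complex.I_ne_zero
    field_simp
    rw [Complex.I_sq]
    ring_nf
  rw [hfun, (hasMellin_sub hI hI').2] at h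
  convert h using 1
  have e1 := mellinOneSubExp_eq h₀ h₁ (r := Complex.I) (by simp) (by simp [Complex.slitPlane])
  have e2 := mellinOneSubExp_eq h₀ h₁ (r := -Complex.I) (by simp) (by simp [Complex.slitPlane])
  unfold mellinOneSubExp at e1 e2
  rw [e1, e2, Complex.cpow_def_of_ne_zero Complex.I_ne_zero,
    Complex.cpow_def_of_ne_zero (neg_ne_zero.mpr Complex.I_ne_zero), Complex.log_I,
    Complex.log_neg_I, Complex.sin, smul_eq_mul]
  have : Complex.I ≠ 0 := Complex.I_ne_zero
  field_simp
  rw [Complex.I_sq]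
  ring_nf

/-! ### Quadratic Taylor coefficients -/

theorem deriv_mul_of_analyticAt {f g : ℂ → ℂ} {z : ℂ} (hf : AnalyticAt ℂ f z)
    (hg : AnalyticAt ℂ g z) :
    deriv (fun s => f s * g s) z = deriv f z * g z + f z * deriv g z :=
  deriv_fun_mul hf.differentiableAt hg.differentiableAt

theorem iteratedDeriv_two_mul {f g : ℂ → ℂ} {z : ℂ} (hf : AnalyticAt ℂ f z)
    (hg : AnalyticAt ℂ g z) :
    iteratedDeriv 2 (fun s => f s * g s) z =
      iteratedDeriv 2 f z * g z + 2 * deriv f z * deriv g z + f z * iteratedDeriv 2 g z := by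
  rw [iteratedDeriv_fun_mul hf.contDiffAt hg.contDiffAt]
  simp [Finset.sum_range_succ]
  ring

theorem analyticAt_Gamma_one_add : AnalyticAt ℂ (fun s => Complex.Gamma (1 + s)) 0 := by
  rw [Complex.analyticAt_iff_eventually_differentiableAt]
  filter_upwards [(isOpen_lt continuous_const (Complex.continuous_re.comp
    (continuous_const_add (1 : ℂ)))).mem_nhds (show (0 : ℂ) ∈ {s : ℂ | 0 < (1 + s).re} by simp)]
    with s hs
  refine (Complex.differentiableAt_Gamma _ fun m h => ?_).comp s (by fun_prop)
  have hs : 0 < (1 + s).re := hs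
  rw [h] at hs
  simp at hs
  linarith [(Nat.cast_nonneg m : (0 : ℝ) ≤ m)]

theorem deriv_Gamma_one_add :
    deriv (fun s => Complex.Gamma (1 + s)) 0 = -(Real.eulerMascheroniConstant : ℂ) := by
  rw [deriv_comp_const_add, add_zero, Complex.hasDerivAt_Gamma_one.deriv]

theorem Gamma_one_add_mul_Gamma_one_sub_mul_sin {s : ℂ} (hs : ‖s‖ < 1) :
    Complex.Gamma (1 + s) * Complex.Gamma (1 + -s) * Complex.sin (Real.pi * s) =
      Real.pi * s := by
  rcases eq_or_ne s 0 with rfl | h0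
  · simp
  have hsin : Complex.sin (Real.pi * s) ≠ 0 := by
    rw [Complex.sin_ne_zero_iff]
    intro k hk
    have hpi : (Real.pi : ℂ) ≠ 0 := by exact_mod_cast Real.pi_ne_zero
    have hk : s = k := mul_left_cancel₀ hpi (by rw [hk, mul_comm])
    rw [hk, Complex.norm_intCast] at hs
    have hk0 : k = 0 := Int.abs_lt_one_iff.mp (by exact_mod_cast hs)
    exact h0 (by rw [hk, hk0, Int.cast_zero])
  rw [add_comm 1 s, Complex.Gamma_add_one s h0, ← sub_eq_add_neg, mul_assoc s,
    Complex.Gamma_mul_Gamma_one_sub, mul_assoc, div_mul_cancel₀ _ hsin, mul_comm]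

/-- `Γ''(1) = γ² + π² / 6`: compare the cubic terms of `Γ(1 + s) Γ(1 - s) sin (π s) = π s`. -/
theorem iteratedDeriv_two_Gamma_one_add :
    iteratedDeriv 2 (fun s => Complex.Gamma (1 + s)) 0 =
      (Real.eulerMascheroniConstant : ℂ) ^ 2 + (Real.pi : ℂ) ^ 2 / 6 := by
  set A : ℂ → ℂ := fun s => Complex.Gamma (1 + s) with hA
  have hA0 : A 0 = 1 := by simp [hA]
  have hAan : AnalyticAt ℂ A 0 := analyticAt_Gamma_one_add
  have hBan : AnalyticAt ℂ (fun s => A (-s)) 0 := by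
    refine AnalyticAt.fun_comp (g := A) ?_ (by fun_prop)
    rwa [neg_zero]
  have hA1 : deriv A 0 = -(Real.eulerMascheroniConstant : ℂ) := deriv_Gamma_one_add
  have hQ1 : deriv (fun s => A s * A (-s)) 0 = 0 := by
    rw [deriv_mul_of_analyticAt hAan hBan, deriv_comp_neg, neg_zero]
    ring
  have hQ2 := iteratedDeriv_two_mul hAan hBan
  rw [deriv_comp_neg, iteratedDeriv_comp_neg, neg_zero, hA0, hA1] at hQ2
  have hS (n : ℕ) : iteratedDeriv n (fun s : ℂ => Complex.sin (Real.pi * s)) 0 =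
      (Real.pi : ℂ) ^ n * iteratedDeriv n Complex.sin 0 := by
    have := congrFun (iteratedDeriv_comp_const_mul (n := n) Complex.contDiff_sin (Real.pi : ℂ)) 0
    simpa using this
  have h3 : iteratedDeriv 3 (fun s => A s * A (-s) * Complex.sin (Real.pi * s)) 0 = 0 := by
    have : (fun s => A s * A (-s) * Complex.sin (Real.pi * s)) =ᶠ[𝓝 0]
        fun s : ℂ => (Real.pi : ℂ) * s := by
      filter_upwards [Metric.ball_mem_nhds (0 : ℂ) one_pos] with s hs
      exact Gamma_one_add_mul_Gamma_one_sub_mul_sin (by simpa using hs)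
    rw [this.iteratedDeriv_eq, iteratedDeriv_const_mul_field]
    simp [iteratedDeriv_fun_id_zero]
  rw [iteratedDeriv_fun_mul (hAan.fun_mul hBan).contDiffAt
    (by fun_prop : ContDiff ℂ 3 fun s : ℂ => Complex.sin (Real.pi * s)).contDiffAt] at h3
  simp only [Finset.sum_range_succ, Finset.sum_range_zero, hS] at h3
  simp [hQ1, hQ2, hA0, Complex.iteratedDeriv_add_one_sin, Complex.iteratedDeriv_add_one_cos,
    Nat.choose] at h3
  have hpi : (Real.pi : ℂ) ≠ 0 := by exact_mod_cast Real.pi_ne_zero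
  have h4 : (Real.pi : ℂ) * (6 * iteratedDeriv 2 A 0 -
      6 * (Real.eulerMascheroniConstant : ℂ) ^ 2 - (Real.pi : ℂ) ^ 2) = 0 := by
    linear_combination h3
  have h5 := (mul_eq_zero.mp h4).resolve_left hpi
  linear_combination h5 / 6

theorem iteratedDeriv_two_cos_mul (a : ℂ) :
    iteratedDeriv 2 (fun s : ℂ => Complex.cos (a * s)) 0 = -a ^ 2 := by
  have := congrFun (iteratedDeriv_comp_const_mul (n := 2) Complex.contDiff_cos a) 0
  rw [this]
  simp [iteratedDeriv_succ]

/-- If `(1 - s) (1 + s c(s)) = Γ(1 + s) cos (π s / 2) exp (-L s)` near `0`, then comparing the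
linear and quadratic terms gives `c'(0)`. -/
theorem deriv_eq_of_one_sub_mul_eq {c : ℂ → ℂ} (L : ℂ) (hc : AnalyticAt ℂ c 0)
    (h : (fun s => (1 - s) * (1 + s * c s)) =ᶠ[𝓝 0] fun s =>
      Complex.Gamma (1 + s) * (Complex.cos (Real.pi / 2 * s) * Complex.exp (-L * s))) :
    deriv c 0 = 1 + 1 / 2 * ((Real.eulerMascheroniConstant : ℂ) - 2) *
      (Real.eulerMascheroniConstant : ℂ) - (Real.pi : ℂ) ^ 2 / 24 +
      L * ((Real.eulerMascheroniConstant : ℂ) - 1 + 1 / 2 * L) := by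
  have hA := analyticAt_Gamma_one_add
  have hcos : AnalyticAt ℂ (fun s : ℂ => Complex.cos (Real.pi / 2 * s)) 0 := by fun_prop
  have hexp : AnalyticAt ℂ (fun s : ℂ => Complex.exp (-L * s)) 0 := by fun_prop
  have hid : AnalyticAt ℂ (fun s : ℂ => s) 0 := by fun_prop
  have h1s : AnalyticAt ℂ (fun s : ℂ => 1 - s) 0 := by fun_prop
  have hg : AnalyticAt ℂ (fun s => 1 + s * c s) 0 := by fun_prop
  have dcos : deriv (fun s : ℂ => Complex.cos (Real.pi / 2 * s)) 0 = 0 := by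
    have := ((hasDerivAt_id (0 : ℂ)).const_mul ((Real.pi : ℂ) / 2)).ccos.deriv
    simpa using this
  have dexp : deriv (fun s : ℂ => Complex.exp (-L * s)) 0 = -L := by
    have := ((hasDerivAt_id (0 : ℂ)).const_mul (-L)).cexp.deriv
    simpa using this
  have ddexp : iteratedDeriv 2 (fun s : ℂ => Complex.exp (-L * s)) 0 = L ^ 2 := by
    rw [iteratedDeriv_cexp_const_mul]; simp
  have dd1s : iteratedDeriv 2 (fun s : ℂ => 1 - s) 0 = 0 := by
    have : deriv (fun s : ℂ => 1 - s) = fun _ => -1 := by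
      funext s
      simp
    simp [iteratedDeriv_succ, this]
  have d1s : deriv (fun s : ℂ => 1 - s) 0 = -1 := by simp
  have dg : deriv (fun s => 1 + s * c s) 0 = c 0 := by
    rw [deriv_const_add, deriv_mul_of_analyticAt hid hc]; simp
  have ddg : iteratedDeriv 2 (fun s => 1 + s * c s) 0 = 2 * deriv c 0 := by
    have : iteratedDeriv 2 (fun s => 1 + s * c s) 0 = iteratedDeriv 2 (fun s => s * c s) 0 := by
      have : deriv (fun s => 1 + s * c s) = deriv (fun s => s * c s) := by
        funext s
        rw [deriv_const_add]
      simp only [iteratedDeriv_succ, iteratedDeriv_zero, this]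
    rw [this, iteratedDeriv_two_mul hid hc]
    simp [iteratedDeriv_fun_id_zero]
  have hA0 : Complex.Gamma (1 + 0) = 1 := by simp
  have e1 := h.deriv_eq
  rw [deriv_mul_of_analyticAt h1s hg, deriv_mul_of_analyticAt hA (hcos.fun_mul hexp),
    deriv_mul_of_analyticAt hcos hexp, dcos, dexp, d1s, dg, deriv_Gamma_one_add, hA0] at e1
  have e2 := h.iteratedDeriv_eq 2
  rw [iteratedDeriv_two_mul h1s hg, iteratedDeriv_two_mul hA (hcos.fun_mul hexp),
    iteratedDeriv_two_mul hcos hexp, deriv_mul_of_analyticAt hcos hexp, dcos, dexp, d1s, dg,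
    dd1s, ddg, ddexp, iteratedDeriv_two_cos_mul, deriv_Gamma_one_add,
    iteratedDeriv_two_Gamma_one_add, hA0] at e2
  simp at e1 e2
  linear_combination e2 / 2 + e1

/-! ### The oscillating integral -/

/-- `sin (κ t) / (κ t)` with its value `1` at the origin subtracted on `(0, 1]`, so that its Mellin
transform is holomorphic around `0`. -/
noncomputable def sincRemainder (κ t : ℝ) : ℝ :=
  Real.sin (κ * t) / (κ * t) - (Ioc 0 1).indicator (fun _ => 1) t

theorem locallyIntegrableOn_sincRemainder {κ : ℝ} (hκ : 0 < κ) :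
    LocallyIntegrableOn (fun t => (sincRemainder κ t : ℂ)) (Ioi 0) := by
  have h1 : LocallyIntegrableOn (fun t : ℝ => ((Real.sin (κ * t) / (κ * t) : ℝ) : ℂ)) (Ioi 0) := by
    refine ContinuousOn.locallyIntegrableOn ?_ measurableSet_Ioi
    refine Complex.continuous_ofReal.comp_continuousOn (ContinuousOn.div (by fun_prop)
      (by fun_prop) fun t ht => ?_)
    exact (mul_pos hκ ht).ne'
  have h2 : LocallyIntegrableOn (fun t : ℝ => (((Ioc 0 1).indicator (fun _ => 1) t : ℝ) : ℂ))
      (Ioi 0) := by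
    have : Integrable ((Ioc (0 : ℝ) 1).indicator fun _ => (1 : ℝ)) :=
      (integrable_indicator_iff measurableSet_Ioc).mpr (integrableOn_const (by simp))
    exact this.ofReal.locallyIntegrable.locallyIntegrableOn _
  convert h1.sub h2 using 2 with t
  simp [sincRemainder]

theorem sincRemainder_isBigO_atTop {κ : ℝ} (hκ : 0 < κ) :
    (fun t => (sincRemainder κ t : ℂ)) =O[atTop] fun t : ℝ => t ^ (-1 : ℝ) := by
  refine IsBigO.of_bound (1 / κ) ?_
  filter_upwards [eventually_gt_atTop (1 : ℝ)] with t ht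
  have ht0 : 0 < t := by linarith
  have : sincRemainder κ t = Real.sin (κ * t) / (κ * t) := by simp [sincRemainder, ht]
  rw [this, Complex.norm_real, norm_div, Real.norm_of_nonneg (by positivity : 0 ≤ κ * t),
    Real.rpow_neg_one, Real.norm_of_nonneg (by positivity : 0 ≤ t⁻¹), ← one_div,
    one_div_mul_one_div]
  gcongr
  exact Real.abs_sin_le_one _

theorem sincRemainder_isBigO_zero {κ : ℝ} (hκ : 0 < κ) :
    (fun t => (sincRemainder κ t : ℂ)) =O[𝓝[>] 0] fun t : ℝ => t ^ (-(-1) : ℝ) := by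
  refine IsBigO.of_bound κ ?_
  have hsmall : Ioc 0 (min 1 (1 / κ)) ∈ 𝓝[>] (0 : ℝ) := Ioc_mem_nhdsGT (by positivity)
  filter_upwards [hsmall] with t ht
  have ht0 : 0 < t := ht.1
  have ht1 : t ≤ 1 := ht.2.trans (min_le_left _ _)
  have hx0 : 0 < κ * t := by positivity
  have hx1 : κ * t ≤ 1 := by
    have := ht.2.trans (min_le_right _ _)
    rw [le_div_iff₀ hκ] at this
    linarith
  have : sincRemainder κ t = Real.sin (κ * t) / (κ * t) - 1 := by simp [sincRemainder, ht0, ht1]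
  rw [this, Complex.norm_real, neg_neg, Real.rpow_one, Real.norm_of_nonneg ht0.le,
    Real.norm_eq_abs, abs_le]
  have hl := Real.sin_gt_sub_cube hx0
  have hu := Real.sin_lt hx0
  constructor
  · rw [le_sub_iff_add_le, le_div_iff₀ hx0]
    nlinarith [mul_pos hx0 hx0, pow_pos hx0 3]
  · rw [sub_le_iff_le_add, div_le_iff₀ hx0]
    nlinarith [mul_pos hx0 hx0]

theorem differentiableAt_mellin_sincRemainder {κ : ℝ} (hκ : 0 < κ) {s : ℂ} (h₀ : -1 < s.re)
    (h₁ : s.re < 1) : DifferentiableAt ℂ (mellin fun t => (sincRemainder κ t : ℂ)) s :=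
  mellin_differentiableAt_of_isBigO_rpow (locallyIntegrableOn_sincRemainder hκ)
    (sincRemainder_isBigO_atTop hκ) h₁ (sincRemainder_isBigO_zero hκ) h₀

theorem mellin_sincRemainder {κ : ℝ} (hκ : 0 < κ) {s : ℂ} (h₀ : 0 < s.re) (h₁ : s.re < 1) :
    mellin (fun t => (sincRemainder κ t : ℂ)) s =
      (κ : ℂ) ^ (-s) * (Complex.Gamma s / (1 - s) * Complex.sin (Real.pi * (1 - s) / 2)) -
        1 / s := by
  have hκ' : (κ : ℂ) ≠ 0 := by exact_mod_cast hκ.ne'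
  have hsin := hasMellin_sin h₀ h₁
  have hconv : MellinConvergent (fun t : ℝ => Complex.sin ((κ * t : ℝ) : ℂ)) (s - 1) :=
    (MellinConvergent.comp_mul_left hκ).mpr hsin.1
  have hval := mellin_comp_mul_left (fun t : ℝ => Complex.sin t) (s - 1) hκ
  rw [hsin.2] at hval
  have h2 := hasMellin_const_smul hconv (κ⁻¹ : ℂ)
  rw [hval] at h2
  have h3 : HasMellin (fun t : ℝ => (t : ℂ) ^ (-1 : ℂ) • ((κ⁻¹ : ℂ) • Complex.sin ((κ * t : ℝ) : ℂ)))
      s _ := ⟨MellinConvergent.cpow_smul.mpr h2.1, (mellin_cpow_smul _ _ _).trans h2.2⟩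
  have h4 := hasMellin_sub h3.1 (hasMellin_one_Ioc h₀).1
  rw [h3.2, (hasMellin_one_Ioc h₀).2] at h4
  convert h4.2 using 2
  · funext t
    simp only [sincRemainder, Complex.cpow_neg_one, smul_eq_mul]
    push_cast
    congr 1
    · rw [div_eq_mul_inv, mul_inv]
      ring
    · by_cases ht : t ∈ Ioc (0 : ℝ) 1 <;> simp [ht]
  · rw [neg_sub, Complex.cpow_sub _ _ hκ', Complex.cpow_one, Complex.cpow_neg]
    simp only [smul_eq_mul]
    field_simp

/-- The Taylor comparison applies because the Mellin transform is known at the points `1 / (n + 2)`,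
which accumulate at `0`. -/
theorem deriv_mellin_sincRemainder {κ : ℝ} (hκ : 0 < κ) :
    deriv (mellin fun t => (sincRemainder κ t : ℂ)) 0 =
      1 + 1 / 2 * ((Real.eulerMascheroniConstant : ℂ) - 2) *
      (Real.eulerMascheroniConstant : ℂ) - (Real.pi : ℂ) ^ 2 / 24 +
      (Real.log κ : ℂ) * ((Real.eulerMascheroniConstant : ℂ) - 1 + 1 / 2 * (Real.log κ : ℂ)) := by
  have hκ' : (κ : ℂ) ≠ 0 := by exact_mod_cast hκ.ne'
  have hc : AnalyticAt ℂ (mellin fun t => (sincRemainder κ t : ℂ)) 0 := by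
    rw [Complex.analyticAt_iff_eventually_differentiableAt]
    filter_upwards [Metric.ball_mem_nhds (0 : ℂ) one_pos] with s hs
    have := (Complex.abs_re_le_norm s).trans_lt (by simpa using hs)
    rw [abs_lt] at this
    exact differentiableAt_mellin_sincRemainder hκ this.1 this.2
  refine deriv_eq_of_one_sub_mul_eq _ hc ?_
  have hA := analyticAt_Gamma_one_add
  refine (AnalyticAt.frequently_eq_iff_eventually_eq (by fun_prop) (by fun_prop)).mp ?_
  have htend : Tendsto (fun n : ℕ => ((1 / ((n : ℝ) + 1 + 1) : ℝ) : ℂ)) atTop (𝓝[≠] 0) := by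
    refine tendsto_nhdsWithin_iff.mpr ⟨?_, Eventually.of_forall fun n => ?_⟩
    · have := (tendsto_one_div_add_atTop_nhds_zero_nat (𝕜 := ℝ)).comp (tendsto_add_atTop_nat 1)
      have := (Complex.continuous_ofReal.tendsto _).comp this
      simpa [Function.comp_def] using this
    · have : (1 / ((n : ℝ) + 1 + 1) : ℝ) ≠ 0 := by positivity
      exact Complex.ofReal_ne_zero.mpr this
  refine htend.frequently (Frequently.of_forall fun n => ?_)
  set x : ℝ := 1 / ((n : ℝ) + 1 + 1) with hx
  have hx0 : 0 < x := by positivity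
  have hx1 : x < 1 := by
    rw [hx, div_lt_one (by positivity)]
    linarith [(Nat.cast_nonneg n : (0 : ℝ) ≤ n)]
  have hxc : (x : ℂ) ≠ 0 := Complex.ofReal_ne_zero.mpr hx0.ne'
  have hxc1 : 1 - (x : ℂ) ≠ 0 := by
    rw [← Complex.ofReal_one, ← Complex.ofReal_sub]
    exact Complex.ofReal_ne_zero.mpr (by linarith)
  rw [mellin_sincRemainder hκ (by simpa using hx0) (by simpa using hx1), add_comm 1 (x : ℂ),
    Complex.Gamma_add_one _ hxc, Complex.cpow_def_of_ne_zero hκ', ← Complex.ofReal_log hκ.le,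
    show (Real.pi : ℂ) * (1 - x) / 2 = Real.pi / 2 - Real.pi / 2 * x by ring,
    Complex.sin_pi_div_two_sub]
  field_simp
  ring_nf

/-- `∑_{m ≥ 1} (-1)^(m-1) κ^(2m) / ((2m)² (2m+1)!)`, indexed from `n = m - 1`. -/
noncomputable def sincLogSeries (κ : ℝ) : ℝ :=
  ∑' n : ℕ, (-1) ^ n * κ ^ (2 * n + 2) / ((2 * n + 2) ^ 2 * ((2 * n + 3).factorial : ℝ))

theorem summable_sincLogSeries (κ : ℝ) : Summable fun n : ℕ =>
    |κ| ^ (2 * n + 2) / ((2 * n + 2) ^ 2 * ((2 * n + 3).factorial : ℝ)) := by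
  have h := (Real.summable_pow_div_factorial |κ|).mul_left |κ|⁻¹
  have hinj : Function.Injective fun n : ℕ => 2 * n + 3 := fun a b h => by
    simpa using h
  refine (h.comp_injective hinj).of_nonneg_of_le (fun n => by positivity) fun n => ?_
  rcases eq_or_ne κ 0 with rfl | hκ
  · simp
  · have hk : |κ| ≠ 0 := abs_ne_zero.mpr hκ
    have : (|κ|⁻¹ * (|κ| ^ (2 * n + 3) / ((2 * n + 3).factorial : ℝ))) =
        |κ| ^ (2 * n + 2) / (1 * ((2 * n + 3).factorial : ℝ)) := by
      rw [pow_succ]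
      field_simp
    simp only [Function.comp_def]
    rw [this]
    gcongr
    have : (0 : ℝ) ≤ n := Nat.cast_nonneg n
    nlinarith

theorem hasDerivAt_pow_mul_log (n : ℕ) {t : ℝ} (ht : t ≠ 0) :
    HasDerivAt (fun t : ℝ => t ^ (n + 1) * Real.log t / (n + 1) - t ^ (n + 1) / (n + 1) ^ 2)
      (t ^ n * Real.log t) t := by
  have h1 := (hasDerivAt_pow (n + 1) t)
  have := ((h1.mul (Real.hasDerivAt_log ht)).div_const ((n : ℝ) + 1)).sub
    (h1.div_const (((n : ℝ) + 1) ^ 2))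
  have hn : (n : ℝ) + 1 ≠ 0 := by positivity
  convert! this using 1
  push_cast
  field_simp
  ring

theorem intervalIntegrable_pow_mul_log (n : ℕ) (a b : ℝ) :
    IntervalIntegrable (fun t : ℝ => t ^ n * Real.log t) volume a b :=
  intervalIntegral.intervalIntegrable_log'.continuousOn_mul (by fun_prop)

theorem integral_pow_mul_log (n : ℕ) :
    ∫ t in Ioc (0 : ℝ) 1, t ^ n * Real.log t = -1 / ((n : ℝ) + 1) ^ 2 := by
  rw [← intervalIntegral.integral_of_le zero_le_one]
  have hcont : ContinuousOn
      (fun t : ℝ => t ^ (n + 1) * Real.log t / (n + 1) - t ^ (n + 1) / (n + 1) ^ 2)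
      (Icc 0 1) := by
    have : (fun t : ℝ => t ^ (n + 1) * Real.log t / (n + 1) - t ^ (n + 1) / (n + 1) ^ 2) =
        fun t => t ^ n * (t * Real.log t) / (n + 1) - t ^ (n + 1) / (n + 1) ^ 2 := by
      funext t
      ring
    rw [this]
    have := Real.continuous_mul_log
    fun_prop
  rw [intervalIntegral.integral_eq_sub_of_hasDerivAt_of_le zero_le_one hcont
    (fun t ht => hasDerivAt_pow_mul_log n ht.1.ne') (intervalIntegrable_pow_mul_log n 0 1)]
  simp
  ring

/-- Integration of the power series of the sine term by term against the logarithm. -/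
theorem integral_log_div_mul_sinc_sub_one {κ : ℝ} (hκ : 0 < κ) :
    ∫ t in Ioc (0 : ℝ) 1, Real.log t / t * (Real.sin (κ * t) / (κ * t) - 1) =
      sincLogSeries κ := by
  set a : ℕ → ℝ := fun n => (-1) ^ (n + 1) * κ ^ (2 * n + 2) / ((2 * n + 3).factorial : ℝ) with ha
  have hlogint (n : ℕ) : IntegrableOn (fun t : ℝ => t ^ (2 * n + 1) * Real.log t) (Ioc 0 1) :=
    (intervalIntegrable_iff_integrableOn_Ioc_of_le zero_le_one).mp
      (intervalIntegrable_pow_mul_log _ 0 1)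
  have hnorm (n : ℕ) : ∫ t in Ioc (0 : ℝ) 1, ‖a n * (t ^ (2 * n + 1) * Real.log t)‖ =
      |κ| ^ (2 * n + 2) / ((2 * n + 2) ^ 2 * ((2 * n + 3).factorial : ℝ)) := by
    have : ∀ t ∈ Ioc (0 : ℝ) 1, ‖a n * (t ^ (2 * n + 1) * Real.log t)‖ =
        -|a n| * (t ^ (2 * n + 1) * Real.log t) := by
      intro t ht
      have h1 : 0 ≤ t ^ (2 * n + 1) := pow_nonneg ht.1.le _
      have h2 : Real.log t ≤ 0 := Real.log_nonpos ht.1.le ht.2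
      rw [norm_mul, Real.norm_eq_abs, Real.norm_eq_abs,
        abs_of_nonpos (mul_nonpos_of_nonneg_of_nonpos h1 h2)]
      ring
    rw [setIntegral_congr_fun measurableSet_Ioc this, integral_const_mul, integral_pow_mul_log,
      ha]
    simp only [abs_div, abs_mul, abs_pow, abs_neg, abs_one, one_pow, one_mul, Nat.abs_cast]
    push_cast
    field_simp
    ring
  have hsum := hasSum_integral_of_summable_integral_norm (μ := volume.restrict (Ioc (0 : ℝ) 1))
    (F := fun n t => a n * (t ^ (2 * n + 1) * Real.log t)) (fun n => (hlogint n).const_mul _)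
    (by simp_rw [hnorm]; exact summable_sincLogSeries κ)
  have hpt : ∀ t ∈ Ioc (0 : ℝ) 1, Real.log t / t * (Real.sin (κ * t) / (κ * t) - 1) =
      ∑' n, a n * (t ^ (2 * n + 1) * Real.log t) := by
    intro t ht
    have ht0 : t ≠ 0 := ht.1.ne'
    have h1 := (hasSum_nat_add_iff' 1).mpr (Real.hasSum_sin (κ * t))
    have h2 := (h1.mul_left (Real.log t / t / (κ * t))).tsum_eq
    simp only [Finset.sum_range_one] at h2
    rw [show Real.log t / t * (Real.sin (κ * t) / (κ * t) - 1) = Real.log t / t / (κ * t) *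
      (Real.sin (κ * t) - (-1) ^ 0 * (κ * t) ^ (2 * 0 + 1) / ((2 * 0 + 1).factorial : ℝ)) by
        simp; field_simp, ← h2]
    refine tsum_congr fun n => ?_
    rw [ha]
    simp only [show 2 * (n + 1) + 1 = 2 * n + 3 by ring]
    rw [mul_pow]
    field_simp
    ring
  rw [setIntegral_congr_fun measurableSet_Ioc hpt, ← hsum.tsum_eq, sincLogSeries]
  refine tsum_congr fun n => ?_
  rw [integral_const_mul, integral_pow_mul_log, ha]
  push_cast
  field_simp
  ring

/-- The right-hand side with `κ = (2k + 1) π` is the `k`-th term of the series. The integral of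
`log t / t` against `sincRemainder κ` over `(0, ∞)` is the derivative at `0` of a Mellin transform;
its part over `(0, 1]` is `sincLogSeries κ`. -/
theorem integral_log_mul_sin {κ : ℝ} (hκ : 0 < κ) :
    ∫ t in Ioi (1 : ℝ), Real.log t / t * (Real.sin (κ * t) / (κ * t)) =
      1 + 1 / 2 * (Real.eulerMascheroniConstant - 2) * Real.eulerMascheroniConstant -
        Real.pi ^ 2 / 24 - sincLogSeries κ +
        Real.log κ * (Real.eulerMascheroniConstant - 1 + 1 / 2 * Real.log κ) := by
  obtain ⟨hconv, hder⟩ := mellin_hasDerivAt_of_isBigO_rpow (s := 0)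
    (locallyIntegrableOn_sincRemainder hκ) (sincRemainder_isBigO_atTop hκ) (by simp)
    (sincRemainder_isBigO_zero hκ) (by simp)
  have hfun : ∀ t : ℝ, (t : ℂ) ^ ((0 : ℂ) - 1) • (Real.log t • (sincRemainder κ t : ℂ)) =
      ((Real.log t / t * sincRemainder κ t : ℝ) : ℂ) := by
    intro t
    rw [zero_sub, Complex.cpow_neg_one, Complex.real_smul, smul_eq_mul]
    push_cast
    ring
  have hmain := deriv_mellin_sincRemainder hκ
  rw [hder.deriv, mellin] at hmain
  unfold MellinConvergent at hconv
  simp_rw [hfun] at hmain hconv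
  have hint : IntegrableOn (fun t => Real.log t / t * sincRemainder κ t) (Ioi 0) := by
    simpa [IntegrableOn] using hconv.re
  rw [integral_complex_ofReal] at hmain
  have hmain' : ∫ t in Ioi (0 : ℝ), Real.log t / t * sincRemainder κ t =
      1 + 1 / 2 * (Real.eulerMascheroniConstant - 2) * Real.eulerMascheroniConstant -
        Real.pi ^ 2 / 24 +
        Real.log κ * (Real.eulerMascheroniConstant - 1 + 1 / 2 * Real.log κ) := by
    refine Complex.ofReal_injective (hmain.trans ?_)
    push_cast
    ring
  rw [← Ioc_union_Ioi_eq_Ioi zero_le_one, setIntegral_union Ioc_disjoint_Ioi_same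
    measurableSet_Ioi (hint.mono_set Ioc_subset_Ioi_self)
    (hint.mono_set (Ioi_subset_Ioi zero_le_one))] at hmain'
  have e1 : ∫ t in Ioc (0 : ℝ) 1, Real.log t / t * sincRemainder κ t = sincLogSeries κ := by
    rw [← integral_log_div_mul_sinc_sub_one hκ]
    refine setIntegral_congr_fun measurableSet_Ioc fun t ht => ?_
    simp [sincRemainder, ht.1, ht.2]
  have e2 : ∫ t in Ioi (1 : ℝ), Real.log t / t * sincRemainder κ t =
      ∫ t in Ioi (1 : ℝ), Real.log t / t * (Real.sin (κ * t) / (κ * t)) := by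
    refine setIntegral_congr_fun measurableSet_Ioi fun t ht => ?_
    have : ¬ t ≤ 1 := not_le.mpr ht
    simp [sincRemainder, this]
  rw [e1, e2] at hmain'
  linarith

/-! ### The hypergeometric term -/

theorem Gamma_five_halves_div_Gamma_add (n : ℕ) :
    Complex.Gamma (5 / 2) / Complex.Gamma (5 / 2 + n) =
      6 * ((n : ℂ) + 1) * 4 ^ n * n.factorial / ((2 * n + 3).factorial : ℂ) := by
  have hre (n : ℕ) : 0 < ((5 / 2 : ℂ) + n).re := by
    have : ((5 / 2 : ℂ) + n).re = 5 / 2 + n := by simp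
    rw [this]
    positivity
  induction n with
  | zero =>
    have := Complex.Gamma_ne_zero_of_re_pos (hre 0)
    simp at this
    simp [div_self this, Nat.factorial]
  | succ n ih =>
    have h0 : (5 / 2 : ℂ) + n ≠ 0 := fun h => by
      have := hre n
      rw [h] at this
      simp at this
    have h1 : (5 + 2 * n : ℂ) ≠ 0 := by exact_mod_cast (by omega : 5 + 2 * n ≠ 0)
    have h2 : (n : ℂ) + 2 ≠ 0 := by exact_mod_cast (by omega : n + 2 ≠ 0)
    have hf : ((2 * n + 3).factorial : ℂ) ≠ 0 := by exact_mod_cast Nat.factorial_ne_zero _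
    have hn : (n : ℂ) + 1 ≠ 0 := by exact_mod_cast n.succ_ne_zero
    have hfac : ((2 * (n + 1) + 3).factorial : ℂ) =
        (5 + 2 * n) * (2 * ((n : ℂ) + 2)) * ((2 * n + 3).factorial : ℂ) := by
      rw [show 2 * (n + 1) + 3 = 2 * n + 3 + 1 + 1 by ring, Nat.factorial_succ (2 * n + 3 + 1),
        Nat.factorial_succ (2 * n + 3)]
      push_cast
      ring
    rw [hfac, Nat.cast_succ, ← add_assoc, Complex.Gamma_add_one _ h0, mul_comm, ← div_div, ih,
      Nat.factorial_succ n, show (5 / 2 : ℂ) + n = (5 + 2 * n) / 2 by ring]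
    push_cast
    field_simp
    ring

theorem sq_div_mul_hypergeometricPFQ (κ : ℝ) :
    (κ : ℂ) ^ 2 / 24 * hypergeometricPFQ {1, 1, 1} {2, 2, 2, 5 / 2} (-((κ : ℂ) ^ 2 / 4)) =
      (sincLogSeries κ : ℂ) := by
  rw [hypergeometricPFQ_three_four, sincLogSeries, Complex.ofReal_tsum, ← tsum_mul_left]
  refine tsum_congr fun n => ?_
  have hf : (n.factorial : ℂ) ≠ 0 := by exact_mod_cast n.factorial_ne_zero
  have hf' : ((2 * n + 3).factorial : ℂ) ≠ 0 := by exact_mod_cast Nat.factorial_ne_zero _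
  have hn : (n : ℂ) + 1 ≠ 0 := by exact_mod_cast n.succ_ne_zero
  rw [Gamma_five_halves_div_Gamma_add, neg_pow, div_pow, ← pow_mul]
  push_cast
  rw [show 2 * (n : ℂ) + 2 = 2 * (n + 1) by ring]
  field_simp
  ring

theorem stieltjesTerm_eq_integral (k : ℕ) :
    stieltjesTerm k = ((∫ t in Set.Ioi (1 : ℝ), Real.log t / t *
      (Real.sin ((2 * k + 1) * Real.pi * t) / ((2 * k + 1) * Real.pi * t)) : ℝ) : ℂ) := by
  have h := sq_div_mul_hypergeometricPFQ ((2 * k + 1) * Real.pi)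
  push_cast at h
  rw [mul_pow] at h
  rw [integral_log_mul_sin (by positivity), stieltjesTerm, h]
  push_cast
  ring

/-! ### Summation over the odd multiples of π -/

theorem hasDerivAt_log_div_sq {t : ℝ} (ht : t ≠ 0) :
    HasDerivAt (fun t : ℝ => Real.log t / t ^ 2) ((1 - 2 * Real.log t) / t ^ 3) t := by
  have := (Real.hasDerivAt_log ht).div (hasDerivAt_pow 2 t) (pow_ne_zero 2 ht)
  convert! this using 1
  field_simp
  push_cast
  ring

theorem hasDerivAt_log_add_one_div {t : ℝ} (ht : t ≠ 0) :
    HasDerivAt (fun t : ℝ => (Real.log t + 1) / t) (-(Real.log t / t ^ 2)) t := by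
  have := ((Real.hasDerivAt_log ht).add_const 1).div (hasDerivAt_id t) ht
  convert! this using 1
  simp
  field_simp
  ring

theorem continuousOn_log_div_sq : ContinuousOn (fun t : ℝ => Real.log t / t ^ 2) (Ioi 1) :=
  fun _ ht => (hasDerivAt_log_div_sq (zero_lt_one.trans ht).ne').continuousAt.continuousWithinAt

theorem integrableOn_log_div_sq : IntegrableOn (fun t : ℝ => Real.log t / t ^ 2) (Ioi 1) := by
  refine Integrable.mono' ((integrableOn_Ioi_rpow_of_lt (a := -(3 / 2)) (by norm_num)
    zero_lt_one).const_mul 2) (continuousOn_log_div_sq.aestronglyMeasurable measurableSet_Ioi) ?_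
  filter_upwards [ae_restrict_mem measurableSet_Ioi] with t ht
  have ht : 1 < t := ht
  have ht0 : 0 < t := by linarith
  have h := Real.log_le_rpow_div ht0.le (ε := 1 / 2) (by norm_num)
  rw [Real.norm_of_nonneg (div_nonneg (Real.log_nonneg ht.le) (by positivity)),
    div_le_iff₀ (by positivity), mul_assoc, ← Real.rpow_natCast, ← Real.rpow_add ht0]
  norm_num at h ⊢
  linarith

theorem integrableOn_deriv_log_div_sq :
    IntegrableOn (fun t : ℝ => (1 - 2 * Real.log t) / t ^ 3) (Ioi 1) := by
  refine Integrable.mono' ((integrableOn_Ioi_rpow_of_lt (a := -2) (by norm_num)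
    zero_lt_one).const_mul 3) ?_ ?_
  · refine ContinuousOn.aestronglyMeasurable (fun t ht => ?_) measurableSet_Ioi
    have ht : t ≠ 0 := (zero_lt_one.trans ht).ne'
    exact ContinuousAt.continuousWithinAt (by fun_prop (disch := positivity))
  filter_upwards [ae_restrict_mem measurableSet_Ioi] with t ht
  have ht : 1 < t := ht
  have ht0 : 0 < t := by linarith
  have h0 := Real.log_nonneg ht.le
  have h1 := Real.log_le_sub_one_of_pos ht0
  rw [norm_div, Real.norm_eq_abs, Real.norm_of_nonneg (by positivity : 0 ≤ t ^ 3),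
    div_le_iff₀ (by positivity), mul_assoc, ← Real.rpow_natCast, ← Real.rpow_add ht0]
  norm_num
  rw [abs_le]
  constructor <;> linarith

theorem tendsto_log_div_sq : Tendsto (fun t : ℝ => Real.log t / t ^ 2) atTop (𝓝 0) := by
  have := isLittleO_log_rpow_atTop (r := 2) (by norm_num)
  simpa using this.tendsto_div_nhds_zero

theorem tendsto_log_add_one_div : Tendsto (fun t : ℝ => (Real.log t + 1) / t) atTop (𝓝 0) := by
  have h1 := (isLittleO_log_rpow_atTop (r := 1) (by norm_num)).tendsto_div_nhds_zero
  simp only [Real.rpow_one] at h1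
  have := h1.add tendsto_inv_atTop_zero
  simp only [add_zero] at this
  refine this.congr fun t => ?_
  rw [add_div, one_div]

/-- Integration by parts; the boundary terms vanish since `log 1 = 0`. -/
theorem integral_log_mul_sin_eq_cos {κ : ℝ} (hκ : 0 < κ) :
    ∫ t in Ioi (1 : ℝ), Real.log t / t * (Real.sin (κ * t) / (κ * t)) =
      ∫ t in Ioi (1 : ℝ), Real.cos (κ * t) / κ ^ 2 * ((1 - 2 * Real.log t) / t ^ 3) := by
  have hi1 : IntegrableOn (fun t : ℝ => Real.sin (κ * t) / κ * (Real.log t / t ^ 2)) (Ioi 1) := by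
    refine integrableOn_log_div_sq.bdd_mul (c := 1 / κ)
      (by fun_prop : Continuous _).aestronglyMeasurable (Eventually.of_forall fun t => ?_)
    rw [norm_div, Real.norm_of_nonneg hκ.le]
    gcongr
    exact Real.abs_sin_le_one _
  have hi2 : IntegrableOn (fun t : ℝ => Real.cos (κ * t) / κ ^ 2 *
      ((1 - 2 * Real.log t) / t ^ 3)) (Ioi 1) := by
    refine integrableOn_deriv_log_div_sq.bdd_mul (c := 1 / κ ^ 2)
      (by fun_prop : Continuous _).aestronglyMeasurable (Eventually.of_forall fun t => ?_)
    rw [norm_div, Real.norm_of_nonneg (by positivity : 0 ≤ κ ^ 2)]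
    gcongr
    exact Real.abs_cos_le_one _
  have hd : ∀ t ∈ Ici (1 : ℝ), HasDerivAt
      (fun t => Real.cos (κ * t) / κ ^ 2 * (Real.log t / t ^ 2))
      (Real.cos (κ * t) / κ ^ 2 * ((1 - 2 * Real.log t) / t ^ 3) -
        Real.sin (κ * t) / κ * (Real.log t / t ^ 2)) t := by
    intro t ht
    have ht0 : t ≠ 0 := (zero_lt_one.trans_le ht).ne'
    have h := (((hasDerivAt_id t).const_mul κ).cos.div_const (κ ^ 2)).mul
      (hasDerivAt_log_div_sq ht0)
    convert! h using 1
    simp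
    field_simp
    ring
  have hlim : Tendsto (fun t : ℝ => Real.cos (κ * t) / κ ^ 2 * (Real.log t / t ^ 2)) atTop
      (𝓝 0) := by
    refine bdd_le_mul_tendsto_zero' (1 / κ ^ 2) (Eventually.of_forall fun t => ?_)
      tendsto_log_div_sq
    rw [abs_div, abs_of_nonneg (by positivity : 0 ≤ κ ^ 2)]
    gcongr
    exact Real.abs_cos_le_one _
  have h := integral_Ioi_of_hasDerivAt_of_tendsto' hd (hi2.sub hi1) hlim
  rw [integral_sub hi2 hi1] at h
  simp only [Real.log_one, zero_div, mul_zero, sub_zero] at h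
  rw [sub_eq_zero.mp h]
  refine setIntegral_congr_fun measurableSet_Ioi fun t ht => ?_
  field_simp

/-- The triangle wave of period `2` that equals `(1 - 2 t) / 8` on `[0, 1]`, defined by its Fourier
series. -/
noncomputable def triangleWave (t : ℝ) : ℝ :=
  ∑' k : ℕ, Real.cos ((2 * k + 1) * Real.pi * t) / ((2 * k + 1) * Real.pi) ^ 2

theorem summable_one_div_odd_mul_pi_sq :
    Summable fun k : ℕ => 1 / ((2 * (k : ℝ) + 1) * Real.pi) ^ 2 := by
  have h := (Real.summable_one_div_nat_pow (p := 2)).mpr one_lt_two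
  have hinj : Function.Injective fun n : ℕ => 2 * n + 1 := fun a b h => by simpa using h
  refine ((h.comp_injective hinj).mul_right (1 / Real.pi ^ 2)).congr fun k => ?_
  simp only [Function.comp_def]
  push_cast
  rw [mul_pow, one_div_mul_one_div]

theorem norm_cos_div_le (k : ℕ) (t : ℝ) :
    ‖Real.cos ((2 * k + 1) * Real.pi * t) / ((2 * k + 1) * Real.pi) ^ 2‖ ≤
      1 / ((2 * (k : ℝ) + 1) * Real.pi) ^ 2 := by
  rw [norm_div, Real.norm_of_nonneg (by positivity : 0 ≤ ((2 * (k : ℝ) + 1) * Real.pi) ^ 2)]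
  gcongr
  exact Real.abs_cos_le_one _

theorem continuous_triangleWave : Continuous triangleWave :=
  continuous_tsum (fun k => by fun_prop) summable_one_div_odd_mul_pi_sq norm_cos_div_le

theorem norm_triangleWave_le (t : ℝ) :
    ‖triangleWave t‖ ≤ ∑' k : ℕ, 1 / ((2 * (k : ℝ) + 1) * Real.pi) ^ 2 :=
  tsum_of_norm_bounded summable_one_div_odd_mul_pi_sq.hasSum fun k => norm_cos_div_le k t

theorem hasSum_cos_div_sq {x : ℝ} (hx : x ∈ Icc (0 : ℝ) 1) :
    HasSum (fun n : ℕ => 1 / (n : ℝ) ^ 2 * Real.cos (2 * Real.pi * n * x))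
      (Real.pi ^ 2 * (x ^ 2 - x + 1 / 6)) := by
  convert! hasSum_one_div_nat_pow_mul_cos one_ne_zero hx using 1
  have hB : (Polynomial.map (algebraMap ℚ ℝ) (Polynomial.bernoulli 2)).eval x =
      x ^ 2 - x + 1 / 6 := by
    simp [Polynomial.bernoulli, Finset.sum_range_succ, bernoulli_two, bernoulli_one,
      Polynomial.map_monomial]
    ring
  rw [mul_one, hB, Nat.factorial_two]
  push_cast
  ring

/-- The sum over odd frequencies is the sum over all of them, taken at `x / 2`, minus the sum over
the even ones; both are values of the Bernoulli polynomial `B₂`. -/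
theorem triangleWave_eq_of_mem_Icc {x : ℝ} (hx : x ∈ Icc (0 : ℝ) 1) :
    triangleWave x = (1 - 2 * x) / 8 := by
  have hpi : Real.pi ≠ 0 := Real.pi_ne_zero
  have hall := hasSum_cos_div_sq (x := x / 2) ⟨by linarith [hx.1], by linarith [hx.2]⟩
  have heven := (hasSum_cos_div_sq hx).mul_left (1 / 4)
  have hodd : HasSum (fun k : ℕ => Real.pi ^ 2 *
      (Real.cos ((2 * k + 1) * Real.pi * x) / ((2 * k + 1) * Real.pi) ^ 2))
      (Real.pi ^ 2 * triangleWave x) :=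
    (summable_one_div_odd_mul_pi_sq.of_norm_bounded fun k => norm_cos_div_le k x).hasSum.mul_left _
  have h := HasSum.even_add_odd (f := fun n : ℕ => 1 / (n : ℝ) ^ 2 *
    Real.cos (2 * Real.pi * n * (x / 2)))
    (by
      convert! heven using 2 with k
      push_cast
      rw [show 2 * Real.pi * (2 * (k : ℝ)) * (x / 2) = 2 * Real.pi * k * x by ring, mul_pow,
        ← mul_assoc, one_div_mul_one_div]
      norm_num)
    (by
      convert! hodd using 2 with k
      push_cast
      rw [show 2 * Real.pi * (2 * (k : ℝ) + 1) * (x / 2) = (2 * k + 1) * Real.pi * x by ring]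
      field_simp)
  have := h.unique hall
  have h2 : Real.pi ^ 2 * (triangleWave x - (1 - 2 * x) / 8) = 0 := by linarith
  have := (mul_eq_zero.mp h2).resolve_left (pow_ne_zero 2 hpi)
  linarith

theorem triangleWave_add_natCast (x : ℝ) (n : ℕ) :
    triangleWave (x + n) = (-1) ^ n * triangleWave x := by
  unfold triangleWave
  rw [← tsum_mul_left]
  refine tsum_congr fun k => ?_
  rw [show (2 * (k : ℝ) + 1) * Real.pi * (x + n) =
    (2 * k + 1) * Real.pi * x + (((2 * k + 1) * n : ℕ) : ℝ) * Real.pi by push_cast; ring,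
    Real.cos_add_nat_mul_pi, pow_mul, pow_succ, pow_mul]
  norm_num
  ring

theorem triangleWave_eq_of_mem_Icc_natCast {n : ℕ} {t : ℝ} (ht : t ∈ Icc (n : ℝ) (n + 1)) :
    triangleWave t = (-1) ^ n * ((1 - 2 * (t - n)) / 8) := by
  rw [← triangleWave_eq_of_mem_Icc ⟨by linarith [ht.1], by linarith [ht.2]⟩,
    ← triangleWave_add_natCast, sub_add_cancel]

theorem integrableOn_triangleWave_mul :
    IntegrableOn (fun t => triangleWave t * ((1 - 2 * Real.log t) / t ^ 3)) (Ioi 1) :=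
  integrableOn_deriv_log_div_sq.bdd_mul continuous_triangleWave.aestronglyMeasurable
    (Eventually.of_forall norm_triangleWave_le)

/-- Summing under the integral is legitimate after the integration by parts. -/
theorem hasSum_integral_log_mul_sin :
    HasSum (fun k : ℕ => ∫ t in Ioi (1 : ℝ), Real.log t / t *
      (Real.sin ((2 * k + 1) * Real.pi * t) / ((2 * k + 1) * Real.pi * t)))
      (∫ t in Ioi (1 : ℝ), triangleWave t * ((1 - 2 * Real.log t) / t ^ 3)) := by
  set φ : ℝ → ℝ := fun t => (1 - 2 * Real.log t) / t ^ 3 with hφ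
  have hint (k : ℕ) : IntegrableOn (fun t : ℝ =>
      Real.cos ((2 * k + 1) * Real.pi * t) / ((2 * k + 1) * Real.pi) ^ 2 * φ t) (Ioi 1) :=
    integrableOn_deriv_log_div_sq.bdd_mul (by fun_prop : Continuous _).aestronglyMeasurable
      (Eventually.of_forall (norm_cos_div_le k))
  have hsum : Summable fun k : ℕ => ∫ t in Ioi (1 : ℝ),
      ‖Real.cos ((2 * k + 1) * Real.pi * t) / ((2 * k + 1) * Real.pi) ^ 2 * φ t‖ := by
    refine (summable_one_div_odd_mul_pi_sq.mul_right (∫ t in Ioi (1 : ℝ), ‖φ t‖)).of_nonneg_of_le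
      (fun k => integral_nonneg fun t => norm_nonneg _) fun k => ?_
    rw [← integral_const_mul]
    refine integral_mono (hint k).norm (integrableOn_deriv_log_div_sq.norm.const_mul _) fun t => ?_
    simp only [norm_mul]
    gcongr
    exact norm_cos_div_le k t
  convert! hasSum_integral_of_summable_integral_norm hint hsum using 2 with k
  · rw [integral_log_mul_sin_eq_cos (by positivity)]
  · simp_rw [tsum_mul_right]
    rfl

theorem integral_triangleWave_mul_unit_interval {n : ℕ} (hn : 1 ≤ n) :
    ∫ t in (n : ℝ)..(n + 1), triangleWave t * ((1 - 2 * Real.log t) / t ^ 3) =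
      (-1) ^ n * (-(Real.log n / (n : ℝ) ^ 2 + Real.log (n + 1) / ((n : ℝ) + 1) ^ 2) / 8 +
        ((Real.log n + 1) / n - (Real.log (n + 1) + 1) / (n + 1)) / 4) := by
  have hn' : (1 : ℝ) ≤ n := by exact_mod_cast hn
  have hpos : ∀ t ∈ uIcc (n : ℝ) (n + 1), t ≠ 0 := by
    intro t ht
    rw [uIcc_of_le (by linarith)] at ht
    linarith [ht.1]
  have hcongr : ∫ t in (n : ℝ)..(n + 1), triangleWave t * ((1 - 2 * Real.log t) / t ^ 3) =
      ∫ t in (n : ℝ)..(n + 1),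
        (-1) ^ n * ((1 - 2 * (t - n)) / 8) * ((1 - 2 * Real.log t) / t ^ 3) := by
    refine intervalIntegral.integral_congr fun t ht => ?_
    rw [uIcc_of_le (by linarith)] at ht
    simp only [triangleWave_eq_of_mem_Icc_natCast ht]
  rw [hcongr, intervalIntegral.integral_eq_sub_of_hasDerivAt
    (f := fun t => (-1) ^ n * ((1 - 2 * (t - n)) / 8 * (Real.log t / t ^ 2) -
      (Real.log t + 1) / t / 4))]
  · ring
  · intro t ht
    have h1 := ((((hasDerivAt_id t).sub_const (n : ℝ)).const_mul 2).const_sub 1).div_const 8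
    have h := ((h1.mul (hasDerivAt_log_div_sq (hpos t ht))).sub
      ((hasDerivAt_log_add_one_div (hpos t ht)).div_const 4)).const_mul ((-1 : ℝ) ^ n)
    convert! h using 1
    simp
    ring
  · refine ContinuousOn.intervalIntegrable fun t ht => ContinuousAt.continuousWithinAt ?_
    have := hpos t ht
    fun_prop (disch := positivity)

/-- The `log n / n²` boundary contributions telescope, while the `(log n + 1) / n` contributions
build up the two alternating series. Stopping at odd integers groups their terms in pairs. -/
theorem integral_triangleWave_mul_one_odd (M : ℕ) :
    ∫ t in (1 : ℝ)..(2 * M + 1), triangleWave t * ((1 - 2 * Real.log t) / t ^ 3) =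
      -(Real.log (2 * M + 1) / (2 * (M : ℝ) + 1) ^ 2) / 8 +
        (1 - (Real.log (2 * M + 1) + 1) / (2 * M + 1)) / 4 +
        (∑ m ∈ Finset.range M, (Real.log (2 * m + 2) / (2 * m + 2) -
          Real.log (2 * m + 1) / (2 * m + 1))) / 2 -
        (∑ m ∈ Finset.range M, (1 / (2 * (m : ℝ) + 1) - 1 / (2 * m + 2))) / 2 := by
  induction M with
  | zero => simp
  | succ M ih =>
    have hint {a b : ℝ} (ha : 1 ≤ a) (hab : a ≤ b) : IntervalIntegrable
        (fun t => triangleWave t * ((1 - 2 * Real.log t) / t ^ 3)) volume a b :=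
      (intervalIntegrable_iff_integrableOn_Ioc_of_le hab).mpr
        (integrableOn_triangleWave_mul.mono_set fun t ht => ha.trans_lt ht.1)
    have hM : (0 : ℝ) ≤ M := Nat.cast_nonneg M
    have h1 := integral_triangleWave_mul_unit_interval (n := 2 * M + 1) (by omega)
    have h2 := integral_triangleWave_mul_unit_interval (n := 2 * M + 2) (by omega)
    push_cast at h1 h2
    rw [show (2 * (M : ℝ) + 1 + 1) = 2 * M + 2 by ring] at h1
    rw [show (2 * (M : ℝ) + 2 + 1) = 2 * M + 3 by ring] at h2
    rw [pow_succ, pow_mul] at h1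
    rw [pow_add, pow_mul] at h2
    norm_num at h1 h2
    push_cast
    rw [show (2 * ((M : ℝ) + 1) + 1) = 2 * M + 3 by ring,
      ← intervalIntegral.integral_add_adjacent_intervals (b := 2 * (M : ℝ) + 2)
        (hint le_rfl (by linarith)) (hint (by linarith) (by linarith)),
      ← intervalIntegral.integral_add_adjacent_intervals (b := 2 * (M : ℝ) + 1)
        (hint le_rfl (by linarith)) (hint (by linarith) (by linarith)), ih, h1, h2,
      Finset.sum_range_succ, Finset.sum_range_succ]
    ring

/-- The partial sum is `H_{2M} - H_M`, and `H_n - log n` converges. -/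
theorem tendsto_sum_one_div_odd_sub_one_div_even :
    Tendsto (fun M : ℕ => ∑ m ∈ Finset.range M, (1 / (2 * (m : ℝ) + 1) - 1 / (2 * m + 2)))
      atTop (𝓝 (Real.log 2)) := by
  have h1 := Real.tendsto_harmonic_sub_log
  have h2 := h1.comp (tendsto_id.const_mul_atTop' (two_pos : 0 < 2) : Tendsto (fun M : ℕ => 2 * M)
    atTop atTop)
  have h3 := (h2.sub h1).add_const (Real.log 2)
  rw [sub_self, zero_add] at h3
  have hsum (M : ℕ) : ∑ m ∈ Finset.range M, (1 / (2 * (m : ℝ) + 1) - 1 / (2 * m + 2)) =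
      (harmonic (2 * M) : ℝ) - (harmonic M : ℝ) := by
    induction M with
    | zero => simp
    | succ M ih =>
      rw [Finset.sum_range_succ, ih, show 2 * (M + 1) = 2 * M + 1 + 1 by ring, harmonic_succ,
        harmonic_succ, harmonic_succ]
      push_cast
      field_simp
      ring
  refine h3.congr' ?_
  filter_upwards [eventually_ge_atTop 1] with M hM
  have hM' : (M : ℝ) ≠ 0 := by positivity
  rw [hsum]
  simp only [Function.comp_def]
  push_cast
  rw [Real.log_mul two_ne_zero hM']
  ring

theorem integral_triangleWave_mul {e : ℝ} (he : HasSum (fun m : ℕ =>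
    Real.log (2 * m + 2) / (2 * m + 2) - Real.log (2 * m + 1) / (2 * m + 1)) e) :
    ∫ t in Ioi (1 : ℝ), triangleWave t * ((1 - 2 * Real.log t) / t ^ 3) =
      1 / 4 + e / 2 - Real.log 2 / 2 := by
  have hodd : Tendsto (fun M : ℕ => 2 * (M : ℝ) + 1) atTop atTop :=
    tendsto_atTop_add_const_right _ _ (tendsto_natCast_atTop_atTop.const_mul_atTop two_pos)
  have h := intervalIntegral_tendsto_integral_Ioi 1 integrableOn_triangleWave_mul hodd
  simp_rw [integral_triangleWave_mul_one_odd] at h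
  have h1 := ((((tendsto_log_div_sq.comp hodd).neg.div_const 8).add
    (((tendsto_log_add_one_div.comp hodd).const_sub 1).div_const 4)).add
    (he.tendsto_sum_nat.div_const 2)).sub (tendsto_sum_one_div_odd_sub_one_div_even.div_const 2)
  refine (tendsto_nhds_unique h h1).trans ?_
  ring

/-! ### The derivative of the alternating zeta function -/

/-- The `m`-th pair of consecutive terms of the alternating series `∑ (-1)^n / (n + 1)^z`. -/
noncomputable def etaPair (m : ℕ) (z : ℂ) : ℂ :=
  1 / (2 * (m : ℂ) + 1) ^ z - 1 / (2 * (m : ℂ) + 2) ^ z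

/-- A neighbourhood of `1` on which the paired series converges uniformly. -/
def etaRegion : Set ℂ := {z | 1 / 2 < z.re} ∩ Metric.ball 0 2

theorem isOpen_etaRegion : IsOpen etaRegion :=
  (isOpen_lt continuous_const Complex.continuous_re).inter Metric.isOpen_ball

theorem one_mem_etaRegion : (1 : ℂ) ∈ etaRegion := by
  constructor
  · norm_num
  · simp

theorem hasDerivAt_one_div_const_cpow {n : ℂ} (hn : n ≠ 0) (z : ℂ) :
    HasDerivAt (fun z : ℂ => 1 / n ^ z) (-(Complex.log n / n ^ z)) z := by
  have hn' : n ^ z ≠ 0 := by simp [Complex.cpow_eq_zero_iff, hn]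
  have h := ((hasDerivAt_id z).const_cpow (c := n) (Or.inl hn)).inv hn'
  simp only [one_div]
  convert! h using 1
  simp
  field_simp

theorem hasDerivAt_etaPair (m : ℕ) (z : ℂ) :
    HasDerivAt (etaPair m) (Complex.log (2 * m + 2) / (2 * (m : ℂ) + 2) ^ z -
      Complex.log (2 * m + 1) / (2 * (m : ℂ) + 1) ^ z) z := by
  have h1 : (2 * (m : ℂ) + 1) ≠ 0 := by exact_mod_cast (by omega : 2 * m + 1 ≠ 0)
  have h2 : (2 * (m : ℂ) + 2) ≠ 0 := by exact_mod_cast (by omega : 2 * m + 2 ≠ 0)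
  convert! (hasDerivAt_one_div_const_cpow h1 z).sub (hasDerivAt_one_div_const_cpow h2 z)
    using 1
  ring

/-- The mean value inequality for `x ↦ x^(-z)` on `[2m + 1, 2m + 2]`. -/
theorem norm_etaPair_le (m : ℕ) {z : ℂ} (hz : z ∈ etaRegion) :
    ‖etaPair m z‖ ≤ 2 * (2 * (m : ℝ) + 1) ^ (-(3 / 2) : ℝ) := by
  have hre : 1 / 2 < z.re := hz.1
  have hnorm : ‖z‖ < 2 := by simpa using hz.2
  have hz0 : z ≠ 0 := by
    rintro rfl
    norm_num at hre
  have hm : (0 : ℝ) ≤ m := Nat.cast_nonneg m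
  have h := norm_image_sub_le_of_norm_deriv_le_segment' (a := 2 * (m : ℝ) + 1)
    (b := 2 * (m : ℝ) + 2) (f := fun x : ℝ => (x : ℂ) ^ (-z))
    (f' := fun x : ℝ => -z * (x : ℂ) ^ (-z - 1)) (C := 2 * (2 * (m : ℝ) + 1) ^ (-(3 / 2) : ℝ))
    (fun x hx => (hasDerivAt_ofReal_cpow_const (by linarith [hx.1])
      (neg_ne_zero.mpr hz0)).hasDerivWithinAt)
    (fun x hx => by
      have hx1 : 1 ≤ x := by linarith [hx.1]
      rw [norm_mul, norm_neg, Complex.norm_cpow_eq_rpow_re_of_pos (by linarith)]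
      have h1 : x ^ (-z - 1).re ≤ x ^ (-(3 / 2) : ℝ) :=
        Real.rpow_le_rpow_of_exponent_le hx1 (by simp; linarith)
      have h2 : x ^ (-(3 / 2) : ℝ) ≤ (2 * (m : ℝ) + 1) ^ (-(3 / 2) : ℝ) :=
        Real.rpow_le_rpow_of_nonpos (by linarith) hx.1 (by norm_num)
      have h3 : 0 ≤ x ^ (-z - 1).re := by positivity
      calc _ ≤ 2 * x ^ (-z - 1).re := by gcongr
        _ ≤ _ := by linarith)
    (2 * (m : ℝ) + 2) ⟨by linarith, le_rfl⟩
  rw [norm_sub_rev] at h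
  push_cast at h
  rw [Complex.cpow_neg, Complex.cpow_neg] at h
  rw [etaPair, one_div, one_div]
  refine h.trans_eq ?_
  ring

theorem summable_etaPair_bound :
    Summable fun m : ℕ => 2 * (2 * (m : ℝ) + 1) ^ (-(3 / 2) : ℝ) := by
  have h := (Real.summable_nat_rpow (p := -(3 / 2))).mpr (by norm_num)
  have hinj : Function.Injective fun n : ℕ => 2 * n + 1 := fun a b h => by simpa using h
  refine ((h.comp_injective hinj).mul_left 2).congr fun m => ?_
  simp

/-- A partial sum of an alternating series, grouped in pairs; a partial sum of odd length has one
term left over. -/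
theorem sum_range_alternating (f : ℕ → ℂ) (N : ℕ) :
    ∑ n ∈ Finset.range N, (-1) ^ n * f n =
      ∑ m ∈ Finset.range (N / 2), (f (2 * m) - f (2 * m + 1)) +
        if Even N then 0 else f (N - 1) := by
  induction N with
  | zero => simp
  | succ N ih =>
    rw [Finset.sum_range_succ, ih]
    rcases Nat.even_or_odd' N with ⟨M, rfl | rfl⟩
    · have h1 : (2 * M + 1) / 2 = M := by omega
      simp [h1, pow_mul, parity_simps]
    · have h1 : (2 * M + 1) / 2 = M := by omega
      have h2 : (2 * M + 1 + 1) / 2 = M + 1 := by omega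
      simp [h1, h2, pow_mul, pow_succ, parity_simps, Finset.sum_range_succ]
      ring

theorem alternatingHurwitzZeta_one_eq_tsum_etaPair {z : ℂ} (hz : z ∈ etaRegion) :
    alternatingHurwitzZeta z 1 = ∑' m : ℕ, etaPair m z := by
  have hre : 1 / 2 < z.re := hz.1
  have hsum : HasSum (fun m => etaPair m z) (∑' m : ℕ, etaPair m z) :=
    (summable_etaPair_bound.of_norm_bounded fun m => norm_etaPair_le m hz).hasSum
  refine HasSum.tsum_eq ?_
  rw [HasSum, SummationFilter.conditional_filter_eq_map_range, tendsto_map'_iff]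
  have hterm : Tendsto (fun n : ℕ => 1 / ((n : ℂ) + 1) ^ z) atTop (𝓝 0) := by
    rw [tendsto_zero_iff_norm_tendsto_zero]
    have h := (tendsto_rpow_neg_atTop (by linarith : 0 < z.re)).comp
      (tendsto_atTop_add_const_right atTop (1 : ℝ) tendsto_natCast_atTop_atTop)
    refine h.congr fun n => ?_
    have hn : (0 : ℝ) < n + 1 := by positivity
    have h1 := Complex.norm_cpow_eq_rpow_re_of_pos hn z
    push_cast at h1
    simp only [Function.comp_def]
    rw [norm_div, norm_one, h1, Real.rpow_neg hn.le, one_div]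
  have hpairs := hsum.tendsto_sum_nat.comp (Nat.tendsto_div_const_atTop two_ne_zero)
  have hlast : Tendsto (fun N : ℕ => if Even N then 0 else 1 / (((N - 1 : ℕ) : ℂ) + 1) ^ z)
      atTop (𝓝 0) := by
    refine squeeze_zero_norm (fun N => ?_) ((hterm.comp (tendsto_sub_atTop_nat 1)).norm.trans
      (by simp))
    split_ifs <;> simp
  have h := hpairs.add hlast
  rw [add_zero] at h
  refine h.congr fun N => ?_
  have := sum_range_alternating (fun n => 1 / ((n : ℂ) + 1) ^ z) N
  simp only [mul_one_div] at this
  simp only [Function.comp_def]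
  rw [this]
  congr 1
  refine Finset.sum_congr rfl fun m _ => ?_
  rw [etaPair]
  push_cast
  ring_nf

/-- Termwise differentiation of the paired series at `z = 1`. -/
theorem hasSum_deriv_alternatingHurwitzZeta_one :
    HasSum (fun m : ℕ => ((Real.log (2 * m + 2) / (2 * m + 2) -
      Real.log (2 * m + 1) / (2 * m + 1) : ℝ) : ℂ))
      (deriv (fun z => alternatingHurwitzZeta z 1) 1) := by
  have h := Complex.hasSum_deriv_of_summable_norm summable_etaPair_bound
    (fun m z _ => (hasDerivAt_etaPair m z).differentiableAt.differentiableWithinAt)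
    isOpen_etaRegion (fun m z hz => norm_etaPair_le m hz) one_mem_etaRegion
  have heq : (fun z => alternatingHurwitzZeta z 1) =ᶠ[𝓝 1] fun z => ∑' m, etaPair m z := by
    filter_upwards [isOpen_etaRegion.mem_nhds one_mem_etaRegion] with z hz
    exact alternatingHurwitzZeta_one_eq_tsum_etaPair hz
  rw [heq.deriv_eq]
  convert! h using 2 with m
  have h1 : (0 : ℝ) ≤ 2 * m + 1 := by positivity
  have h2 : (0 : ℝ) ≤ 2 * m + 2 := by positivity
  rw [(hasDerivAt_etaPair m 1).deriv, Complex.cpow_one, Complex.cpow_one]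
  push_cast [Complex.ofReal_log h1, Complex.ofReal_log h2]
  rfl

end

theorem corollary3p4 :
    Summable stieltjesTerm ∧
      modifiedStieltjes 1 1 =
        1 / 2 - (Real.log 2 : ℂ) - 2 * ∑' k : ℕ, stieltjesTerm k := by
  have hderiv := hasSum_deriv_alternatingHurwitzZeta_one
  obtain ⟨e, he⟩ := Complex.summable_ofReal.mp hderiv.summable
  have hD := hderiv.unique (Complex.hasSum_ofReal.mpr he)
  have hT := Complex.hasSum_ofReal.mpr hasSum_integral_log_mul_sin
  simp_rw [← stieltjesTerm_eq_integral, integral_triangleWave_mul he] at hT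
  refine ⟨hT.summable, ?_⟩
  rw [hT.tsum_eq, modifiedStieltjes, iteratedDeriv_one, hD]
  push_cast
  ring
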